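/- Let $E$ be a real vector space, let $R:E\to\mathbb{R}\cup\{+\infty\}$ and $f:\mathbb{R}^m\to\mathbb{R}\cup\{+\infty\}$ be convex, and let $\Phi:E\to\mathbb{R}^m$ be linear and surjective. Let $\mathcal S$ be the set of minimizers of $u\mapsto R(u)+f(\Phi u)$ over $E$. Let $p\in\mathcal S$ with $R(p)+f(\Phi p)<+\infty$, and assume that the level set $L=\{u\in E: R(u)\le R(p)\}$ is linearly closed, that is, its intersection with every line is closed in that line. Conventions. A face of a convex set $C$ is a convex subset $F\subseteq C$ that contains every open interval $I\subseteq C$ which meets $F$; its dimension is that of its affine hull. For $x\in C$, $\mathcal F_x(C)$ denotes the intersection of all faces of $C$ containing $x$. An extreme ray of $C$ is a half-line that is a face of $C$. For a subspace $W$ of $E$, $\pi_W:E\to E/W$ is the canonical projection. Let $K=\{v\in E: L+\mathbb{R}v\subseteq L\}$ be the lineality space of $L$, $N=\ker\Phi$, $d=\dim\Phi(K)$, and $\ell=\dim\mathcal F_{\Phi p}(\{w\in\mathbb{R}^m: f(w)\le f(\Phi p)\})$. Suppose that $\pi_{K\cap N}(\mathcal F_p(\mathcal S))$ has finite dimension $j$.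 Put $k=m-\ell+j-d-1$ if $R(p)>\inf R$ or $f(\Phi p)>\inf f$, and $k=m-\ell+j-d$ otherwise. Then: 1. $\pi_K(p)$ belongs to a face of $\pi_K(L)$ of dimension at most $k$; 2. $\pi_K(p)$ is a convex combination either of at most $k+1$ extreme points of $\pi_K(L)$, or of at most $k$ points of $\pi_K(L)$, each of which is an extreme point or lies in an extreme ray of $\pi_K(L)$. If $\theta_1,\dots,\theta_r$ are the weights and $p_1,\dots,p_r\in L$ are any representatives of the points in this combination, then $p=\sum_{i=1}^r\theta_ip_i+u_K$ for some $u_K\in K$. Suppose in addition that $p$ satisfies the double obliqueness condition: with $M=R(p)+f(\Phi p)$, the direction space of $\mathcal F_{p}(L)$, embedded as $\{(v,0)\}$, has codimension one in the direction space of the affine hull of $\mathcal F_{(p,R(p))}(\{(u,r)\in E\times\mathbb{R}:R(u)\le r\})$, and the direction space of $\mathcal F_{\Phi p}(\{w: f(w)\le f(\Phi p)\})$, embedded in the same way, has codimension one in the direction space of the affine hull of $\mathcal F_{(\Phi p,\,M-f(\Phi p))}(\{(w,r)\in\mathbb{R}^m\times\mathbb{R}: r\le M-f(w)\})$. Then 1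 and 2 hold with $k=m-\ell+j-d-2$. -/

import Mathlib

namespace ConvexRepr

section Faces

variable {V : Type*} [AddCommGroup V] [Module ℝ V]

/-- `F` is a face of the convex set `C`: a convex subset of `C` that contains every open interval
of `C` which meets it. The endpoints of the interval need not belong to `C` or to `F`, so the open
interval `(0, 1)` is a face of `[0, 1]`. (Degenerate intervals `{x}` impose no condition.) -/
def IsFace (C F : Set V) : Prop :=
  F ⊆ C ∧ Convex ℝ F ∧
    ∀ x y : V, openSegment ℝ x y ⊆ C → (openSegment ℝ x y ∩ F).Nonempty → openSegment ℝ x y ⊆ F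

/-- The elementary (minimal) face of `x` in `C`: the intersection of all faces of `C` that
contain `x`. -/
def elemFace (C : Set V) (x : V) : Set V :=
  ⋂₀ {F : Set V | IsFace C F ∧ x ∈ F}

/-- The linear space parallel to the affine hull of `S` has dimension `n`; in particular, it is
finite-dimensional. -/
def HasDim (S : Set V) (n : ℕ) : Prop :=
  Module.rank ℝ (vectorSpan ℝ S) = n

/-- `W` is contained in `U` with codimension one. -/
def IsHyperplaneIn (W U : Submodule ℝ V) : Prop :=
  W ≤ U ∧ Module.rank ℝ (U ⧸ W.submoduleOf U) = 1

/-- The intersection of `C` with every line is closed in that line. -/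
def LinearlyClosed (C : Set V) : Prop :=
  ∀ x v : V, IsClosed {t : ℝ | x + t • v ∈ C}

/-- The lineality space of `C`: all `v` with `C + ℝ v ⊆ C`. -/
def lineality (C : Set V) : Submodule ℝ V where
  carrier := {v : V | ∀ x ∈ C, ∀ t : ℝ, x + t • v ∈ C}
  zero_mem' := by
    intro x hx t
    simpa using hx
  add_mem' := by
    intro v w hv hw x hx t
    have h := hw _ (hv x hx t) t
    rwa [add_assoc, ← smul_add] at h
  smul_mem' := by
    intro c v hv x hx t
    have h := hv x hx (t * c)
    rwa [mul_smul] at h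

/-- An extreme ray of `C`: a half-line (with or without its origin) that is a face of `C`. -/
def IsExtremeRay (C ρ : Set V) : Prop :=
  (∃ a v : V, v ≠ 0 ∧
    (ρ = {x | ∃ t : ℝ, 0 < t ∧ x = a + t • v} ∨ ρ = {x | ∃ t : ℝ, 0 ≤ t ∧ x = a + t • v})) ∧
  IsFace C ρ

/-- The points of `C` that are extreme points of `C` or lie in an extreme ray of `C`. -/
def extremeOrRayPoints (C : Set V) : Set V :=
  {x | x ∈ C.extremePoints ℝ ∨ ∃ ρ, IsExtremeRay C ρ ∧ x ∈ ρ}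

end Faces

section Functions

variable {V : Type*} [AddCommGroup V] [Module ℝ V]

/-- Sublevel set `{u | g u ≤ c}`. -/
def levelSet (g : V → EReal) (c : EReal) : Set V := {u | g u ≤ c}

/-- Epigraph of `g`. -/
def epi (g : V → EReal) : Set (V × ℝ) := {q | g q.1 ≤ (q.2 : EReal)}

/-- Hypograph of `g`. -/
def hypo (g : V → EReal) : Set (V × ℝ) := {q | (q.2 : EReal) ≤ g q.1}

/-- A convex function with values in `ℝ ∪ {+∞}`. -/
def IsConvexFun (g : V → EReal) : Prop :=
  (∀ u, g u ≠ ⊥) ∧ Convex ℝ (epi g)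

end Functions

section Problem

variable {E : Type*} [AddCommGroup E] [Module ℝ E] {m : ℕ}

/-- The set of minimizers of `u ↦ R u + f (Φ u)`. -/
def solutionSet (R : E → EReal) (f : (Fin m → ℝ) → EReal) (Φ : E →ₗ[ℝ] (Fin m → ℝ)) : Set E :=
  {u | ∀ v, R u + f (Φ u) ≤ R v + f (Φ v)}

/-- Double obliqueness at `p`. With `M = R p + f (Φ p)`, the elementary face of `(p, R p)` in the
epigraph of `R`, and that of `(Φ p, M - f (Φ p))` in the hypograph of `M - f`, are both oblique: the
direction space of the elementary face in the corresponding level set, placed at height `0`, has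
codimension one in the direction space of the face. -/
def DoublyOblique (R : E → EReal) (f : (Fin m → ℝ) → EReal) (Φ : E →ₗ[ℝ] (Fin m → ℝ)) (p : E) :
    Prop :=
  IsHyperplaneIn
    ((vectorSpan ℝ (elemFace (levelSet R (R p)) p)).prod (⊥ : Submodule ℝ ℝ))
    (vectorSpan ℝ (elemFace (epi R) (p, (R p).toReal))) ∧
  IsHyperplaneIn
    ((vectorSpan ℝ (elemFace (levelSet f (f (Φ p))) (Φ p))).prod (⊥ : Submodule ℝ ℝ))
    (vectorSpan ℝ (elemFace (hypo fun w => R p + f (Φ p) - f w)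
      (Φ p, (R p + f (Φ p) - f (Φ p)).toReal)))

/-- `p` modulo `K` is a convex combination of at most `N` points of `A ⊆ E ⧸ K`; and, for any
representatives in `L` of these points, `p` is the convex combination of the representatives with
the same weights, up to an element of `K`. -/
def IsConvexCombination (K : Submodule ℝ E) (L : Set E) (A : Set (E ⧸ K)) (p : E) (N : ℤ) : Prop :=
  ∃ (r : ℕ) (θ : Fin r → ℝ) (q : Fin r → E ⧸ K),
    (r : ℤ) ≤ N ∧ (∀ i, 0 ≤ θ i) ∧ ∑ i, θ i = 1 ∧ (∀ i, q i ∈ A) ∧ K.mkQ p = ∑ i, θ i • q i ∧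
    ∀ P : Fin r → E, (∀ i, P i ∈ L ∧ K.mkQ (P i) = q i) →
      ∃ u ∈ K, p = ∑ i, θ i • P i + u

/-- The description of `p` in the level set `L`, modulo the subspace `K`, with dimension bound `k`:
the class of `p` lies in a face of dimension at most `k`, and it is a convex combination of at most
`k + 1` extreme points, or of at most `k` points that are extreme or lie in an extreme ray. -/
def RepresentedModulo (K : Submodule ℝ E) (L : Set E) (p : E) (k : ℤ) : Prop :=
  (∃ F : Set (E ⧸ K), IsFace (K.mkQ '' L) F ∧ K.mkQ p ∈ F ∧ ∃ n : ℕ, HasDim F n ∧ (n : ℤ) ≤ k) ∧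
  (IsConvexCombination K L ((K.mkQ '' L).extremePoints ℝ) p (k + 1) ∨
    IsConvexCombination K L (extremeOrRayPoints (K.mkQ '' L)) p k)

end Problem

end ConvexRepr

open ConvexRepr

/-! Let `U`, `G`, `D` be the spaces of directions in which one can move both ways from `p` in `L`,
from `Φ p` in the level set of `f`, and from `p` in the solution set. They are the direction spaces
of the elementary faces (`vectorSpan_elemFace`). A move along `v ∈ U` with `Φ v ∈ G` raises neither
`R` nor `f`, so `U ⊓ G.comap Φ ≤ D`. Counting dimensions modulo `K ⊓ ker Φ` gives `dim U/K + d + ℓ ≤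
dim (Φ U + G) + j` (`finrank_map_mkQ_add_le`).

The ambient bound `m` for `dim (Φ U + G)` settles the general case. If `R` or `f` is not minimal, `Φ
U + G` is a proper subspace (`map_dirSpace_sup_ne_top`), which gains one. Under double obliqueness,
the face directions of the epigraph and of the hypograph project onto spaces strictly larger than
`U` and `G`. The inclusion in `D` survives, because optimality makes the two slopes cancel
(`dirSpace_epi_inf_comap_le`). This gains two.

Finally, `L` modulo `K` is linearly closed and contains no line, so a bound on `dim U/K` becomes a
representation by Klee's theorem with Carathéodory's count (`klee_caratheodory`). -/

namespace ConvexRepr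

/-! ### Elementary faces and their direction spaces. -/

section Directions

variable {V : Type*} [AddCommGroup V] [Module ℝ V]

/-- The segment from `y` to `x` can be prolonged beyond `x` to a point of `C`. -/
def Dominates (C : Set V) (x y : V) : Prop := ∃ ε : ℝ, 0 < ε ∧ x + ε • (x - y) ∈ C

lemma Dominates.refl {C : Set V} {x : V} (hx : x ∈ C) : Dominates C x x :=
  ⟨1, one_pos, by simpa using hx⟩

lemma dominates_of_combination {C : Set V} {x y z : V} {a b : ℝ} (ha : 0 < a) (hb : 0 ≤ b)
    (hab : a + b = 1) (hx : x = a • y + b • z) (hxC : x ∈ C) (hz : z ∈ C) : Dominates C x y := by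
  rcases hb.eq_or_lt with rfl | hb
  · have : a = 1 := by linarith
    subst this
    have : x = y := by simpa using hx
    subst this
    exact Dominates.refl hxC
  · refine ⟨a / b, by positivity, ?_⟩
    have : x + (a / b) • (x - y) = z := by
      have h : b • (x + (a / b) • (x - y)) = b • z := by
        rw [smul_add, smul_smul, mul_div_cancel₀ _ hb.ne']
        have h1 : b • x + a • (x - y) = (a + b) • x - a • y := by module
        rw [h1, hab, hx]
        module
      exact smul_right_injective V hb.ne' h
    rwa [this]

lemma Dominates.exists_combination {C : Set V} {x y : V} (h : Dominates C x y) :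
    ∃ z ∈ C, ∃ a b : ℝ, 0 < a ∧ 0 < b ∧ a + b = 1 ∧ x = a • y + b • z := by
  obtain ⟨ε, hε, h⟩ := h
  refine ⟨_, h, ε / (1 + ε), 1 / (1 + ε), by positivity, by positivity, by field_simp; ring, ?_⟩
  match_scalars <;> field_simp <;> ring

lemma Dominates.trans {C : Set V} (hC : Convex ℝ C) {x y z : V} (hx : x ∈ C)
    (hxy : Dominates C x y) (hyz : Dominates C y z) : Dominates C x z := by
  obtain ⟨x', hx', a, b, ha, hb, hab, rfl⟩ := hxy.exists_combination
  obtain ⟨y', hy', c, d, hc, hd, hcd, rfl⟩ := hyz.exists_combination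
  have hs : 0 < a * d + b := by positivity
  -- Substituting one combination into the other leaves, besides the term in `z`, a remainder of
  -- weight `a * d + b`; normalised, it is a point of `C`.
  have hw := hC hy' hx' (a := a * d / (a * d + b)) (b := b / (a * d + b)) (by positivity)
    (by positivity) (by field_simp)
  refine dominates_of_combination (a := a * c) (b := a * d + b) (by positivity) hs.le
    (by nlinarith) ?_ hx hw
  match_scalars <;> field_simp

lemma Dominates.convex {C : Set V} (hC : Convex ℝ C) {x : V} (hx : x ∈ C) {y z : V}
    (hy : Dominates C x y) (hz : Dominates C x z) {a b : ℝ} (ha : 0 ≤ a) (hb : 0 ≤ b)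
    (hab : a + b = 1) : Dominates C x (a • y + b • z) := by
  obtain ⟨ε, hε, hy⟩ := hy
  obtain ⟨δ, hδ, hz⟩ := hz
  have key : ∀ w : V, ∀ η : ℝ, x + η • (x - w) ∈ C → ∀ κ, 0 < κ → κ ≤ η →
      x + κ • (x - w) ∈ C := by
    intro w η h κ hκ hle
    have hη : 0 < η := by linarith
    have := hC hx h (a := 1 - κ / η) (b := κ / η)
      (by rw [sub_nonneg, div_le_one hη]; exact hle) (by positivity) (by ring)
    convert this using 1
    match_scalars <;> field_simp <;> ring
  have hm : 0 < min ε δ := lt_min hε hδ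
  refine ⟨min ε δ, hm, ?_⟩
  have := hC (key y ε hy _ hm (min_le_left _ _)) (key z δ hz _ hm (min_le_right _ _)) ha hb hab
  convert this using 1
  obtain rfl : b = 1 - a := by linarith
  module

/-- Any two points of an open segment contained in `C` dominate each other. -/
lemma dominates_of_mem_openSegment {C : Set V} {u v x y : V} (h : openSegment ℝ u v ⊆ C)
    (hx : x ∈ openSegment ℝ u v) (hy : y ∈ openSegment ℝ u v) : Dominates C x y := by
  obtain ⟨a, b, ha, hb, hab, rfl⟩ := hx
  obtain ⟨c, d, hc, hd, hcd, rfl⟩ := hy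
  obtain rfl : b = 1 - a := by linarith
  obtain rfl : d = 1 - c := by linarith
  have hm : 0 < min a (1 - a) := lt_min ha hb
  have h1 := min_le_left a (1 - a)
  have h2 := min_le_right a (1 - a)
  -- Since `|a - c| < 1`, a step of half the smaller weight of `x` keeps both weights positive.
  refine ⟨min a (1 - a) / 2, by positivity, h ⟨a + min a (1 - a) / 2 * (a - c),
    1 - a - min a (1 - a) / 2 * (a - c), by nlinarith, by nlinarith, by ring, ?_⟩⟩
  module

lemma isFace_dominates {C : Set V} (hC : Convex ℝ C) {x : V} (hx : x ∈ C) :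
    IsFace C {y | y ∈ C ∧ Dominates C x y ∧ Dominates C y x} := by
  refine ⟨fun y hy => hy.1, ?_, ?_⟩
  · intro y hy z hz a b ha hb hab
    have hw := hC hy.1 hz.1 ha hb hab
    refine ⟨hw, hy.2.1.convex hC hx hz.2.1 ha hb hab, ?_⟩
    rcases ha.eq_or_lt with rfl | ha
    · obtain rfl : b = 1 := by linarith
      simpa using hz.2.2
    · exact (dominates_of_combination ha hb hab rfl hw hz.1).trans hC hw hy.2.2
  · rintro u v huv ⟨y, hy, hyG⟩ z hz
    exact ⟨huv hz, hyG.2.1.trans hC hx (dominates_of_mem_openSegment huv hy hz),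
      (dominates_of_mem_openSegment huv hz hy).trans hC (huv hz) hyG.2.2⟩

/-- The points in mutual domination with `x` form a face. Conversely, prolonging the segment beyond
both ends gives an open interval of `C` through `x` and `y`, which every face containing `x` must
contain. -/
lemma mem_elemFace_iff {C : Set V} (hC : Convex ℝ C) {x y : V} (hx : x ∈ C) :
    y ∈ elemFace C x ↔ y ∈ C ∧ Dominates C x y ∧ Dominates C y x := by
  constructor
  · intro h
    exact h _ ⟨isFace_dominates hC hx, hx, Dominates.refl hx, Dominates.refl hx⟩
  · rintro ⟨-, ⟨ε, hε, h1⟩, ⟨δ, hδ, h2⟩⟩ F ⟨hF, hxF⟩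
    refine hF.2.2 _ _ (hC.openSegment_subset h1 h2) ⟨x, ?_, hxF⟩ ?_
    · refine ⟨(1 + δ) / (1 + ε + δ), ε / (1 + ε + δ), by positivity, by positivity,
        by field_simp; ring, ?_⟩
      match_scalars <;> field_simp <;> ring
    · refine ⟨δ / (1 + ε + δ), (1 + ε) / (1 + ε + δ), by positivity, by positivity,
        by field_simp; ring, ?_⟩
      match_scalars <;> field_simp <;> ring

lemma isFace_elemFace {C : Set V} (hC : Convex ℝ C) {x : V} (hx : x ∈ C) :
    IsFace C (elemFace C x) := by
  have : elemFace C x = {y | y ∈ C ∧ Dominates C x y ∧ Dominates C y x} :=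
    Set.ext fun y => mem_elemFace_iff hC hx
  rw [this]
  exact isFace_dominates hC hx

lemma self_mem_elemFace (C : Set V) (x : V) : x ∈ elemFace C x := fun _ hF => hF.2

lemma add_smul_mem_of_le {C : Set V} (hC : Convex ℝ C) {x v : V} (hx : x ∈ C) {s t : ℝ}
    (hs : 0 ≤ s) (hst : s ≤ t) (h : x + t • v ∈ C) : x + s • v ∈ C := by
  rcases hs.eq_or_lt with rfl | hs
  · simpa using hx
  have ht : 0 < t := by linarith
  have := hC hx h (a := 1 - s / t) (b := s / t)
    (by rw [sub_nonneg, div_le_one ht]; exact hst) (by positivity) (by ring)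
  convert this using 1
  match_scalars <;> field_simp <;> ring

/-- The directions in which one can move from `x` inside `C` both ways. -/
def dirSpace (C : Set V) (hC : Convex ℝ C) (x : V) (hx : x ∈ C) : Submodule ℝ V where
  carrier := {v | ∃ ε : ℝ, 0 < ε ∧ x + ε • v ∈ C ∧ x - ε • v ∈ C}
  zero_mem' := ⟨1, one_pos, by simpa using hx, by simpa using hx⟩
  add_mem' := by
    rintro v w ⟨ε, hε, h1, h2⟩ ⟨δ, hδ, h3, h4⟩
    have hm : 0 < min ε δ := lt_min hε hδ
    rw [sub_eq_add_neg, ← smul_neg] at h2 h4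
    have k1 := add_smul_mem_of_le hC hx hm.le (min_le_left _ _) h1
    have k2 := add_smul_mem_of_le hC hx hm.le (min_le_left _ _) h2
    have k3 := add_smul_mem_of_le hC hx hm.le (min_le_right _ _) h3
    have k4 := add_smul_mem_of_le hC hx hm.le (min_le_right _ _) h4
    refine ⟨min ε δ / 2, by positivity, ?_, ?_⟩
    · convert hC k1 k3 (a := 1 / 2) (b := 1 / 2) (by norm_num) (by norm_num) (by norm_num) using 1
      module
    · convert hC k2 k4 (a := 1 / 2) (b := 1 / 2) (by norm_num) (by norm_num) (by norm_num) using 1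
      module
  smul_mem' := by
    rintro c v ⟨ε, hε, h1, h2⟩
    rcases lt_trichotomy c 0 with hc | rfl | hc
    · have hc' := hc.ne
      refine ⟨ε / (-c), div_pos hε (by linarith), ?_, ?_⟩
      · convert h2 using 1
        match_scalars <;> field_simp
      · convert h1 using 1
        match_scalars <;> field_simp
    · exact ⟨1, one_pos, by simpa using hx, by simpa using hx⟩
    · refine ⟨ε / c, by positivity, ?_, ?_⟩
      · convert h1 using 1
        match_scalars <;> field_simp
      · convert h2 using 1
        match_scalars <;> field_simp

lemma mem_dirSpace {C : Set V} {hC : Convex ℝ C} {x : V} {hx : x ∈ C} {v : V} :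
    v ∈ dirSpace C hC x hx ↔ ∃ ε : ℝ, 0 < ε ∧ x + ε • v ∈ C ∧ x - ε • v ∈ C := Iff.rfl

lemma exists_forall_of_mem_dirSpace {C : Set V} {hC : Convex ℝ C} {x : V} {hx : x ∈ C} {v : V}
    (h : v ∈ dirSpace C hC x hx) :
    ∃ ε : ℝ, 0 < ε ∧ ∀ t : ℝ, |t| ≤ ε → x + t • v ∈ C := by
  obtain ⟨ε, hε, h1, h2⟩ := h
  refine ⟨ε, hε, fun t ht => ?_⟩
  rw [sub_eq_add_neg, ← smul_neg] at h2
  rcases le_total 0 t with h0 | h0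
  · exact add_smul_mem_of_le hC hx h0 ((le_abs_self t).trans ht) h1
  · have := add_smul_mem_of_le hC hx (neg_nonneg.2 h0) ((neg_le_abs t).trans ht) h2
    simpa using this

lemma sub_mem_dirSpace {C : Set V} {hC : Convex ℝ C} {x : V} {hx : x ∈ C} {y : V} (hy : y ∈ C)
    (h : Dominates C x y) : y - x ∈ dirSpace C hC x hx := by
  obtain ⟨ε, hε, h⟩ := h
  have hm : 0 < min ε 1 := lt_min hε one_pos
  refine ⟨min ε 1, hm, ?_, ?_⟩
  · exact add_smul_mem_of_le hC hx hm.le (min_le_right _ _) (by simpa using hy)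
  · rw [sub_eq_add_neg, ← smul_neg, neg_sub]
    exact add_smul_mem_of_le hC hx hm.le (min_le_left _ _) h

lemma vectorSpan_elemFace {C : Set V} (hC : Convex ℝ C) {x : V} (hx : x ∈ C) :
    vectorSpan ℝ (elemFace C x) = dirSpace C hC x hx := by
  apply le_antisymm
  · rw [vectorSpan_eq_span_vsub_set_right ℝ (self_mem_elemFace C x), Submodule.span_le]
    rintro _ ⟨y, hy, rfl⟩
    have hy := (mem_elemFace_iff hC hx).1 hy
    exact sub_mem_dirSpace hy.1 hy.2.1
  · intro v hv
    obtain ⟨ε, hε, hv⟩ := exists_forall_of_mem_dirSpace hv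
    -- Half the admissible step leaves room to prolong the segment beyond both ends.
    have h : x + (ε / 2) • v ∈ elemFace C x := by
      refine (mem_elemFace_iff hC hx).2 ⟨hv _ ?_, ⟨1, one_pos, ?_⟩, ⟨1, one_pos, ?_⟩⟩
      · rw [abs_of_pos (by positivity)]; linarith
      · convert hv (-(ε / 2)) (by rw [abs_neg, abs_of_pos (by positivity)]; linarith) using 1
        module
      · convert hv ε (by rw [abs_of_pos hε]) using 1
        match_scalars <;> ring
    have h2 := vsub_mem_vectorSpan ℝ h (self_mem_elemFace C x)
    have h3 := Submodule.smul_mem _ (2 / ε) h2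
    convert h3 using 1
    simp only [vsub_eq_sub]
    match_scalars <;> field_simp <;> simp

/-- With `x = a • y + b • z`, moving `y` by `±ε • v` while `z` stays fixed moves `x` by `±(a * ε) •
v`. -/
lemma dirSpace_mono {C : Set V} {hC : Convex ℝ C} {x y : V} {hx : x ∈ C} {hy : y ∈ C}
    (h : Dominates C x y) : dirSpace C hC y hy ≤ dirSpace C hC x hx := by
  rintro v ⟨ε, hε, h1, h2⟩
  obtain ⟨z, hz, a, b, ha, hb, hab, rfl⟩ := h.exists_combination
  refine ⟨a * ε, by positivity, ?_, ?_⟩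
  · convert hC h1 hz ha.le hb.le hab using 1
    module
  · convert hC h2 hz ha.le hb.le hab using 1
    module

lemma mem_extremePoints_of_dirSpace_eq_bot {C : Set V} {hC : Convex ℝ C} {x : V} {hx : x ∈ C}
    (h : dirSpace C hC x hx = ⊥) : x ∈ C.extremePoints ℝ := by
  refine ⟨hx, fun y hy z hz hxyz => ?_⟩
  obtain ⟨a, b, ha, hb, hab, hxe⟩ := hxyz
  have := sub_mem_dirSpace (hC := hC) (hx := hx) hy
    (dominates_of_combination ha hb.le hab hxe.symm hx hz)
  rw [h, Submodule.mem_bot, sub_eq_zero] at this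
  exact this

end Directions

/-! ### Klee's theorem for linearly closed convex sets without lines. -/

section Klee

variable {V : Type*} [AddCommGroup V] [Module ℝ V]

/-- The points of the open extreme rays of `C` whose origin is an extreme point of `C`. -/
def openRayPoints (C : Set V) : Set V :=
  {x | ∃ a v : V, v ≠ 0 ∧ a ∈ C.extremePoints ℝ ∧ IsFace C {y | ∃ t : ℝ, 0 < t ∧ y = a + t • v} ∧
    ∃ t : ℝ, 0 < t ∧ x = a + t • v}

/-- The points that are extreme or lie in an open extreme ray with extreme origin. -/
def klee (C : Set V) : Set V := C.extremePoints ℝ ∪ openRayPoints C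

lemma klee_subset_extremeOrRayPoints (C : Set V) : klee C ⊆ extremeOrRayPoints C := by
  rintro x (h | ⟨a, v, hv, -, hF, hx⟩)
  · exact Or.inl h
  · exact Or.inr ⟨_, ⟨⟨a, v, hv, Or.inl rfl⟩, hF⟩, hx⟩

lemma klee_subset (C : Set V) : klee C ⊆ C := by
  rintro x (h | ⟨a, v, -, -, hF, hx⟩)
  · exact h.1
  · exact hF.1 hx

/-- `C` contains no line. -/
def LineFree (C : Set V) : Prop := ∀ x v : V, (∀ t : ℝ, x + t • v ∈ C) → v = 0

/-- The half-line from `x` in direction `v` stays in `C`. -/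
def Recedes (C : Set V) (x v : V) : Prop := ∀ t : ℝ, 0 ≤ t → x + t • v ∈ C

lemma LineFree.eq_zero {C : Set V} (h : LineFree C) {x v : V} (h1 : Recedes C x v)
    (h2 : Recedes C x (-v)) : v = 0 := by
  refine h x v fun t => ?_
  rcases le_total 0 t with ht | ht
  · exact h1 t ht
  · simpa using h2 (-t) (neg_nonneg.2 ht)

lemma exists_exit {C : Set V} (hC : Convex ℝ C) (hcl : LinearlyClosed C) {x v : V} (hx : x ∈ C)
    (h : ¬ Recedes C x v) :
    ∃ τ : ℝ, 0 ≤ τ ∧ x + τ • v ∈ C ∧ ∀ t : ℝ, x + t • v ∈ C → t ≤ τ := by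
  simp only [Recedes, not_forall] at h
  obtain ⟨T, hT, hTC⟩ := h
  have hbd : BddAbove {t : ℝ | x + t • v ∈ C} := by
    refine ⟨T, fun t ht => ?_⟩
    by_contra hlt
    exact hTC (add_smul_mem_of_le hC hx hT (not_le.1 hlt).le ht)
  have h0 : (0 : ℝ) ∈ {t : ℝ | x + t • v ∈ C} := by simpa using hx
  exact ⟨_, le_csSup hbd h0, (hcl x v).csSup_mem ⟨0, h0⟩ hbd, fun t ht => le_csSup hbd ht⟩

/-- The exit point is dominated by `x`, because `x` can also move along `-v`. It loses the direction
`v` by maximality of `τ`. This strict drop drives the induction in `mem_convexHull_klee`. -/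
lemma exists_exit_of_mem_dirSpace {C : Set V} (hC : Convex ℝ C) (hcl : LinearlyClosed C) {x v : V}
    (hx : x ∈ C) (hv : v ∈ dirSpace C hC x hx) (h : ¬ Recedes C x v) :
    ∃ τ : ℝ, 0 < τ ∧ (∀ t : ℝ, x + t • v ∈ C → t ≤ τ) ∧
      ∃ hy : x + τ • v ∈ C, dirSpace C hC _ hy < dirSpace C hC x hx := by
  obtain ⟨τ, -, hτ, hmax⟩ := exists_exit hC hcl hx h
  obtain ⟨ε, hε, h1, h2⟩ := mem_dirSpace.1 hv
  have hτ0 : 0 < τ := hε.trans_le (hmax _ h1)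
  refine ⟨τ, hτ0, hmax, hτ, lt_of_le_of_ne (dirSpace_mono ⟨ε / τ, by positivity, ?_⟩) ?_⟩
  · convert h2 using 1
    match_scalars <;> field_simp
    simp
  · intro he
    rw [← he] at hv
    obtain ⟨δ, hδ, h3, -⟩ := mem_dirSpace.1 hv
    have := hmax (τ + δ) (by convert h3 using 1; module)
    linarith

/-- Otherwise, up to signs, both `v` and `w` recede. The segment from `v` to `-w` is then covered by
two closed sets: the directions that recede and those whose opposite recedes. By connectedness they
share a direction, which must vanish because there are no lines. This contradicts independence. -/
lemma exists_direction_not_recedes {C : Set V} (hcl : LinearlyClosed C) (hlf : LineFree C)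
    {x v w : V} (D : Submodule ℝ V) (hv : v ∈ D) (hw : w ∈ D)
    (hvw : ∀ s t : ℝ, s • v + t • w = 0 → s = 0 ∧ t = 0) :
    ∃ u ∈ D, ¬ Recedes C x u ∧ ¬ Recedes C x (-u) := by
  by_contra! hcon
  have hcon : ∀ u ∈ D, Recedes C x u ∨ Recedes C x (-u) := fun u hu => by
    by_cases h : Recedes C x u
    · exact Or.inl h
    · exact Or.inr (hcon u hu h)
  wlog hv' : Recedes C x v generalizing v
  · refine this (D.neg_mem hv) (fun s t h => ?_) ((hcon v hv).resolve_left hv')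
    have := hvw (-s) t (by simpa using h)
    exact ⟨neg_eq_zero.1 this.1, this.2⟩
  wlog hw' : Recedes C x w generalizing w
  · refine this (D.neg_mem hw) (fun s t h => ?_) ((hcon w hw).resolve_left hw')
    have := hvw s (-t) (by simpa using h)
    exact ⟨this.1, neg_eq_zero.1 this.2⟩
  have hclosed : ∀ a b : V, IsClosed {s : ℝ | Recedes C x (a + s • b)} := by
    intro a b
    have : {s : ℝ | Recedes C x (a + s • b)} =
        ⋂ t : ℝ, ⋂ _ : 0 ≤ t, {s : ℝ | (x + t • a) + s • (t • b) ∈ C} := by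
      ext s
      simp only [Recedes, Set.mem_ofPred_eq, Set.mem_iInter]
      refine forall₂_congr fun t _ => ?_
      rw [show x + t • (a + s • b) = (x + t • a) + s • (t • b) by module]
    rw [this]
    exact isClosed_iInter fun t => isClosed_iInter fun _ => hcl _ _
  obtain ⟨s, -, hs1, hs2⟩ := isPreconnected_closed_iff.1 (isPreconnected_Icc (a := (0 : ℝ)) (b := 1))
    _ _ (hclosed v (-(v + w))) (hclosed (-v) (v + w))
    (fun s _ => by
      rcases hcon (v + s • (-(v + w)))
        (D.add_mem hv (D.smul_mem _ (D.neg_mem (D.add_mem hv hw)))) with h | h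
      · exact Or.inl h
      · refine Or.inr ?_
        rwa [show -(v + s • (-(v + w))) = -v + s • (v + w) by module] at h)
    ⟨0, by simp, by simpa using hv'⟩ ⟨1, by simp, by simpa using hw'⟩
  have hz : v + s • (-(v + w)) = 0 := by
    refine hlf.eq_zero hs1 ?_
    rwa [show -(v + s • (-(v + w))) = -v + s • (v + w) by module]
  have := hvw (1 - s) (-s) (by rw [← hz]; module)
  linarith [this.1, this.2]

lemma mem_openRayPoints {C : Set V} (hC : Convex ℝ C) (hcl : LinearlyClosed C) (hlf : LineFree C)
    {x v : V} (hx : x ∈ C) (hv : v ≠ 0) (hspan : ∀ w, w ∈ dirSpace C hC x hx ↔ ∃ c : ℝ, c • v = w)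
    (hrec : Recedes C x v) : x ∈ openRayPoints C := by
  have hnr : ¬ Recedes C x (-v) := fun h => hv (hlf.eq_zero hrec h)
  have hvD : -v ∈ dirSpace C hC x hx := (hspan _).2 ⟨-1, by simp⟩
  obtain ⟨τ, hτ, hmax, ha, hlt⟩ := exists_exit_of_mem_dirSpace hC hcl hx hvD hnr
  set a := x + τ • (-v) with hadef
  have hxa : x = a + τ • v := by rw [hadef]; module
  have hray : ∀ t : ℝ, 0 ≤ t → a + t • v ∈ C := by
    intro t ht
    refine add_smul_mem_of_le hC ha ht (t := τ + t) (by linarith) ?_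
    convert hrec t ht using 1
    rw [hxa]; module
  have hpos : ∀ t : ℝ, a + t • v ∈ C → 0 ≤ t := by
    intro t ht
    have := hmax (τ - t) (by convert ht using 1; rw [hxa]; module)
    linarith
  refine ⟨a, v, hv, mem_extremePoints_of_dirSpace_eq_bot (hC := hC) (hx := ha) ?_, ?_, τ, hτ, hxa⟩
  · rw [eq_bot_iff]
    intro w hw
    obtain ⟨c, rfl⟩ := (hspan w).1 (hlt.le hw)
    by_cases hc : c = 0
    · simp [hc]
    · refine absurd ?_ hlt.not_ge
      intro w' hw'
      obtain ⟨c', rfl⟩ := (hspan w').1 hw'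
      have := Submodule.smul_mem _ (c' / c) hw
      rwa [smul_smul, div_mul_cancel₀ _ hc] at this
  -- The open ray is a face because it is the elementary face of `x`.
  · have : {y | ∃ t : ℝ, 0 < t ∧ y = a + t • v} = elemFace C x := by
      ext y
      rw [mem_elemFace_iff hC hx]
      constructor
      · rintro ⟨t, ht, rfl⟩
        refine ⟨hray t ht.le, ⟨τ / t, by positivity, ?_⟩, ⟨t / τ, by positivity, ?_⟩⟩
        · convert hray (τ * τ / t) (by positivity) using 1
          rw [hxa]
          match_scalars <;> field_simp <;> ring
        · convert hray (t * t / τ) (by positivity) using 1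
          rw [hxa]
          match_scalars <;> field_simp <;> ring
      · rintro ⟨hy, hxy, δ, hδ, hyx⟩
        obtain ⟨c, hc⟩ := (hspan _).1 (sub_mem_dirSpace (hC := hC) (hx := hx) hy hxy)
        have hy' : y = a + (τ + c) • v := by
          rw [← sub_add_cancel y x, ← hc, hxa]; module
        refine ⟨τ + c, ?_, hy'⟩
        -- If `τ + c ≤ 0`, then `c < 0`, and prolonging beyond `y` would leave the ray past its
        -- origin.
        have := hpos (τ + c + δ * c) (by
          convert hyx using 1
          rw [← hc, hy']; module)
        by_contra hcon
        nlinarith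
    rw [this]
    exact isFace_elemFace hC hx

/-- Induction on the dimension of the elementary face. If some direction recedes neither way, `x`
lies between two exit points with smaller faces. If there is none, the dimension is at most one, and
`x` is extreme or lies on an open extreme ray. -/
lemma mem_convexHull_klee {C : Set V} (hC : Convex ℝ C) (hcl : LinearlyClosed C)
    (hlf : LineFree C) (n : ℕ) : ∀ {x : V} (hx : x ∈ C) [FiniteDimensional ℝ (dirSpace C hC x hx)],
    Module.finrank ℝ (dirSpace C hC x hx) = n → x ∈ convexHull ℝ (klee C) := by
  induction n using Nat.strong_induction_on with
  | _ n ih =>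
  intro x hx _ hn
  have hlower : ∀ y (hy : y ∈ C), dirSpace C hC y hy < dirSpace C hC x hx →
      y ∈ convexHull ℝ (klee C) := by
    intro y hy hlt
    have := Submodule.finiteDimensional_of_le hlt.le
    exact ih _ (hn ▸ Submodule.finrank_lt_finrank_of_lt hlt) hy rfl
  by_cases h : ∃ u ∈ dirSpace C hC x hx, ¬ Recedes C x u ∧ ¬ Recedes C x (-u)
  · obtain ⟨u, hu, h1, h2⟩ := h
    obtain ⟨s, hs, -, hy, hlt⟩ := exists_exit_of_mem_dirSpace hC hcl hx hu h1
    obtain ⟨t, ht, -, hz, hlt'⟩ :=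
      exists_exit_of_mem_dirSpace hC hcl hx (Submodule.neg_mem _ hu) h2
    have := convex_convexHull ℝ (klee C) (hlower _ hy hlt) (hlower _ hz hlt')
      (a := t / (s + t)) (b := s / (s + t)) (by positivity) (by positivity) (by field_simp; ring)
    convert this using 1
    match_scalars <;> field_simp <;> ring
  · have hle : n ≤ 1 := by
      by_contra! hlt
      rw [← hn] at hlt
      have : Nontrivial (dirSpace C hC x hx) := Module.nontrivial_of_finrank_pos (R := ℝ) (by omega)
      obtain ⟨v, hv⟩ := exists_ne (0 : dirSpace C hC x hx)
      obtain ⟨w, hw⟩ := exists_linearIndependent_pair_of_one_lt_finrank hlt hv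
      rw [LinearIndependent.pair_iff] at hw
      exact h (exists_direction_not_recedes hcl hlf _ v.2 w.2 fun s t hst =>
        hw s t (Subtype.ext (by simpa using hst)))
    apply subset_convexHull
    interval_cases n
    · exact Or.inl (mem_extremePoints_of_dirSpace_eq_bot (Submodule.finrank_eq_zero.1 hn))
    · right
      obtain ⟨v, hv, hspan⟩ := finrank_eq_one_iff'.1 hn
      have hspan' : ∀ w, w ∈ dirSpace C hC x hx ↔ ∃ c : ℝ, c • (v : V) = w := by
        intro w
        constructor
        · intro hw
          obtain ⟨c, hc⟩ := hspan ⟨w, hw⟩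
          exact ⟨c, congrArg Subtype.val hc⟩
        · rintro ⟨c, rfl⟩
          exact Submodule.smul_mem _ _ v.2
      have hv' : (v : V) ≠ 0 := by simpa using hv
      by_cases hr : Recedes C x v
      · exact mem_openRayPoints hC hcl hlf hx hv' hspan' hr
      · have hr' : Recedes C x (-(v : V)) := by
          by_contra hr'
          exact h ⟨v, v.2, hr, hr'⟩
        refine mem_openRayPoints hC hcl hlf hx (neg_ne_zero.2 hv') (fun w => ?_) hr'
        rw [hspan']
        exact ⟨fun ⟨c, hc⟩ => ⟨-c, by simpa using hc⟩, fun ⟨c, hc⟩ => ⟨-c, by simpa using hc⟩⟩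

/-- `x` is a convex combination of `r` points of `A`, repetitions allowed. -/
def IsComb (A : Set V) (x : V) (r : ℕ) : Prop :=
  ∃ (θ : Fin r → ℝ) (q : Fin r → V),
    (∀ i, 0 ≤ θ i) ∧ ∑ i, θ i = 1 ∧ (∀ i, q i ∈ A) ∧ x = ∑ i, θ i • q i

lemma exists_isComb_of_mem_convexHull {A : Set V} {x : V} (h : x ∈ convexHull ℝ A) :
    ∃ r, IsComb A x r := by
  obtain ⟨ι, _, w, z, hw, hw1, hz, rfl⟩ := mem_convexHull_iff_exists_fintype.1 h
  let e := Fintype.equivFin ι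
  exact ⟨_, w ∘ e.symm, z ∘ e.symm, fun i => hw _, by simpa [Equiv.sum_comp e.symm w] using hw1,
    fun i => hz _, (Equiv.sum_comp e.symm fun i => w i • z i).symm⟩

lemma exists_isComb_lt_of_weight_eq_zero {A : Set V} {r : ℕ} {θ : Fin r → ℝ} {q : Fin r → V}
    (h0 : ∀ i, 0 ≤ θ i) (h1 : ∑ i, θ i = 1) (hq : ∀ i, q i ∈ A) {i : Fin r} (hi : θ i = 0) :
    ∃ r' < r, IsComb A (∑ i, θ i • q i) r' := by
  obtain ⟨r, rfl⟩ : ∃ s, r = s + 1 := ⟨r - 1, by have := i.2; omega⟩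
  refine ⟨r, by omega, θ ∘ i.succAbove, q ∘ i.succAbove, fun _ => h0 _, ?_, fun _ => hq _, ?_⟩
  · rw [Fin.sum_univ_succAbove _ i, hi, zero_add] at h1
    exact h1
  · rw [Fin.sum_univ_succAbove _ i, hi, zero_smul, zero_add]
    rfl

/-- The ratio test: the largest step `t` that keeps `θ - t • β` nonnegative makes one weight vanish.
-/
lemma exists_max_multiple {r : ℕ} {θ β : Fin r → ℝ} (hθ : ∀ i, 0 < θ i) (hβ : ∃ i, 0 < β i) :
    ∃ t : ℝ, 0 < t ∧ (∃ i, t * β i = θ i) ∧ ∀ i, t * β i ≤ θ i := by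
  classical
  obtain ⟨i, hi, hmin⟩ := Finset.exists_min_image (Finset.univ.filter fun i => 0 < β i)
    (fun i => θ i / β i) (by obtain ⟨i, hi⟩ := hβ; exact ⟨i, by simpa using hi⟩)
  simp only [Finset.mem_filter, Finset.mem_univ, true_and] at hi hmin
  have hpos := div_pos (hθ i) hi
  refine ⟨θ i / β i, hpos, ⟨i, div_mul_cancel₀ _ hi.ne'⟩, fun k => ?_⟩
  rcases lt_or_ge 0 (β k) with hk | hk
  · exact (le_div_iff₀ hk).1 (hmin k hk)
  · nlinarith [hθ k, mul_nonneg hpos.le (neg_nonneg.2 hk)]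

lemma dominates_of_isComb {C : Set V} (hC : Convex ℝ C) {r : ℕ} {θ : Fin r → ℝ} {q : Fin r → V}
    (h0 : ∀ i, 0 ≤ θ i) (h1 : ∑ i, θ i = 1) (hq : ∀ i, q i ∈ C) {i : Fin r} (hi : 0 < θ i) :
    Dominates C (∑ i, θ i • q i) (q i) := by
  classical
  refine ⟨θ i, hi, ?_⟩
  -- The coefficients of `(1 + θ i) • x - θ i • q i`; the one at `k = i` is `θ i ^ 2`, whence the
  -- step `θ i`.
  have := hC.sum_mem (t := Finset.univ) (w := fun k => (1 + θ i) * θ k - if k = i then θ i else 0)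
    (z := q) (fun k _ => by
      split_ifs with h
      · subst h; nlinarith [h0 k]
      · nlinarith [h0 k, h0 i, mul_nonneg (h0 k) (h0 i)])
    (by simp [← Finset.mul_sum, h1]) (fun k _ => hq k)
  convert this using 1
  simp only [sub_smul, Finset.sum_sub_distrib, ite_smul, zero_smul, Finset.sum_ite_eq',
    Finset.mem_univ, if_true, mul_smul, ← Finset.smul_sum]
  module

/-- A point that is not a convex combination of fewer points of `A` only has affinely independent
representations. -/
lemma eq_zero_of_isComb_minimal {A : Set V} {r : ℕ} {θ : Fin r → ℝ} {q : Fin r → V}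
    (h0 : ∀ i, 0 < θ i) (h1 : ∑ i, θ i = 1) (hq : ∀ i, q i ∈ A)
    (hmin : ∀ r' < r, ¬ IsComb A (∑ i, θ i • q i) r') {β : Fin r → ℝ} (hβ : ∑ i, β i = 0)
    (hβq : ∑ i, β i • q i = 0) : β = 0 := by
  by_contra hne
  obtain ⟨i, -, hi⟩ : ∃ i ∈ Finset.univ, 0 < β i := by
    refine Finset.exists_pos_of_sum_zero_of_exists_nonzero _ hβ ?_
    obtain ⟨i, hi⟩ := Function.ne_iff.1 hne
    exact ⟨i, Finset.mem_univ i, hi⟩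
  obtain ⟨t, ht, ⟨k, hk⟩, hle⟩ := exists_max_multiple h0 ⟨i, hi⟩
  obtain ⟨r', hr', h⟩ := exists_isComb_lt_of_weight_eq_zero (θ := fun i => θ i - t * β i)
    (i := k) (fun i => sub_nonneg.2 (hle i))
    (by simp [Finset.sum_sub_distrib, ← Finset.mul_sum, h1, hβ]) hq (by simp [hk])
  refine hmin r' hr' ?_
  simpa [sub_smul, Finset.sum_sub_distrib, mul_smul, ← Finset.smul_sum, hβq] using h

/-- Klee's theorem with Carathéodory's count: a point of a linearly closed convex set without lines
whose elementary face has dimension `n` is a convex combination of at most `n + 1` extreme points or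
of at most `n` points that are extreme or lie in an extreme ray. -/
theorem klee_caratheodory {C : Set V} (hC : Convex ℝ C) (hcl : LinearlyClosed C)
    (hlf : LineFree C) {x : V} (hx : x ∈ C) [FiniteDimensional ℝ (dirSpace C hC x hx)] :
    (∃ r ≤ Module.finrank ℝ (dirSpace C hC x hx) + 1, IsComb (C.extremePoints ℝ) x r) ∨
      ∃ r ≤ Module.finrank ℝ (dirSpace C hC x hx), IsComb (klee C) x r := by
  classical
  have hex := exists_isComb_of_mem_convexHull (mem_convexHull_klee hC hcl hlf _ hx rfl)
  set n := Module.finrank ℝ (dirSpace C hC x hx) with hn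
  set r := Nat.find hex with hr
  have hmin : ∀ r' < r, ¬ IsComb (klee C) x r' := fun r' h => Nat.find_min hex h
  rcases le_or_gt r n with hrn | hrn
  · exact Or.inr ⟨r, hrn, Nat.find_spec hex⟩
  left
  -- A zero weight could be dropped, against the minimality of `r`.
  have hpos : ∀ (θ : Fin r → ℝ) (q : Fin r → V), (∀ i, 0 ≤ θ i) → ∑ i, θ i = 1 →
      (∀ i, q i ∈ klee C) → x = ∑ i, θ i • q i → ∀ i, 0 < θ i := by
    intro θ q h0 h1 hq hx i
    refine (h0 i).lt_of_ne' fun hi => ?_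
    obtain ⟨r', hr', h⟩ := exists_isComb_lt_of_weight_eq_zero h0 h1 hq hi
    exact hmin r' hr' (hx ▸ h)
  have hspan : ∀ (θ : Fin r → ℝ) (q : Fin r → V), (∀ i, 0 ≤ θ i) → ∑ i, θ i = 1 →
      (∀ i, q i ∈ klee C) → x = ∑ i, θ i • q i → r = n + 1 ∧
      ∀ v ∈ dirSpace C hC x hx, ∃ β : Fin r → ℝ, ∑ i, β i = 1 ∧ ∑ i, β i • q i = x + v := by
    intro θ q h0 h1 hq hxq
    have hp := hpos θ q h0 h1 hq hxq
    have hqD : ∀ i, q i - x ∈ dirSpace C hC x hx := fun i =>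
      sub_mem_dirSpace (klee_subset C (hq i))
        (by
          have := dominates_of_isComb hC h0 h1 (fun i => klee_subset C (hq i)) (hp i)
          rwa [← hxq] at this)
    -- `T` records the affine coordinates relative to `x`. Minimality makes it injective; with `r >
    -- n` the dimensions agree, so it is bijective and every `x + v` is an affine combination of the
    -- `q i`.
    let T : (Fin r → ℝ) →ₗ[ℝ] dirSpace C hC x hx × ℝ :=
      (Fintype.linearCombination ℝ (fun i => (⟨q i - x, hqD i⟩ : dirSpace C hC x hx))).prod
        (Fintype.linearCombination ℝ (fun _ => (1 : ℝ)))
    have hT1 : ∀ β, ((T β).1 : V) = ∑ i, β i • q i - (∑ i, β i) • x := by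
      intro β
      simp [T, Fintype.linearCombination_apply, smul_sub, Finset.sum_sub_distrib, Finset.sum_smul]
    have hT2 : ∀ β, (T β).2 = ∑ i, β i := by
      intro β
      simp [T, Fintype.linearCombination_apply]
    have hinj : Function.Injective T := by
      rw [← LinearMap.ker_eq_bot, LinearMap.ker_eq_bot']
      intro β hβ
      have e2 : ∑ i, β i = 0 := by rw [← hT2, hβ]; rfl
      have e1 := hT1 β
      rw [hβ, e2] at e1
      refine eq_zero_of_isComb_minimal hp h1 hq (by rwa [← hxq]) e2 ?_
      simpa using e1.symm
    have hdim : Module.finrank ℝ (dirSpace C hC x hx × ℝ) = n + 1 := by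
      simp [hn]
    have hle := LinearMap.finrank_le_finrank_of_injective hinj
    rw [hdim, Module.finrank_fin_fun] at hle
    have hrn' : r = n + 1 := by omega
    have hsurj : Function.Surjective T :=
      (LinearMap.injective_iff_surjective_of_finrank_eq_finrank
        (by rw [hdim, Module.finrank_fin_fun, hrn'])).1 hinj
    refine ⟨hrn', fun v hv => ?_⟩
    obtain ⟨β, hβ⟩ := hsurj (⟨v, hv⟩, 1)
    have e2 : ∑ i, β i = 1 := by rw [← hT2, hβ]
    have e1 := hT1 β
    rw [hβ, e2, one_smul] at e1
    exact ⟨β, e2, by simp at e1; rw [e1]; abel⟩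
  -- Exchange argument, by induction on the number `s` of non-extreme points: one of them is traded
  -- for the origin of its ray, with `r` unchanged.
  have key : ∀ (s : ℕ) (θ : Fin r → ℝ) (q : Fin r → V), (∀ i, 0 ≤ θ i) → ∑ i, θ i = 1 →
      (∀ i, q i ∈ klee C) → x = ∑ i, θ i • q i →
      (Finset.univ.filter fun i => q i ∉ C.extremePoints ℝ).card = s →
      IsComb (C.extremePoints ℝ) x r := by
    intro s
    induction s with
    | zero =>
      intro θ q h0 h1 hq hxq hs
      rw [Finset.card_eq_zero, Finset.filter_eq_empty_iff] at hs
      exact ⟨θ, q, h0, h1, fun i => not_not.1 (hs (Finset.mem_univ i)), hxq⟩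
    | succ s ih =>
      intro θ q h0 h1 hq hxq hs
      have hp := hpos θ q h0 h1 hq hxq
      obtain ⟨i, hi⟩ := Finset.card_pos.1 ((Nat.succ_pos s).trans_eq hs.symm)
      have hi' : q i ∉ C.extremePoints ℝ := by simpa using hi
      obtain ⟨a, v, hv, ha, hF, u, hu, hqi⟩ := (hq i).resolve_left hi'
      have hray : ∀ t : ℝ, 0 ≤ t → a + t • v ∈ klee C := by
        intro t ht
        rcases ht.eq_or_lt with rfl | ht
        · left; simpa using ha
        · exact Or.inr ⟨a, v, hv, ha, hF, t, ht, rfl⟩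
      have hdom : Dominates C x (q i) := by
        have := dominates_of_isComb hC h0 h1 (fun i => klee_subset C (hq i)) (hp i)
        rwa [← hxq] at this
      have hvD : v ∈ dirSpace C hC x hx := by
        refine dirSpace_mono (hy := klee_subset C (hq i)) hdom (mem_dirSpace.2 ⟨u, hu, ?_, ?_⟩)
        · rw [hqi, add_assoc, ← add_smul]
          exact klee_subset C (hray _ (by linarith))
        · rw [hqi, add_sub_cancel_right]
          exact ha.1
      have haD : a - x ∈ dirSpace C hC x hx := by
        have h := Submodule.sub_mem _ (sub_mem_dirSpace (klee_subset C (hq i)) hdom)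
          (Submodule.smul_mem _ u hvD)
        convert h using 1
        rw [hqi]; module
      -- The origin `a` is an affine combination of the `q l`, so weight `t` can be transferred to
      -- `a` until some weight `k` vanishes.
      obtain ⟨β, hβ1, hβ⟩ := (hspan θ q h0 h1 hq hxq).2 _ haD
      rw [add_sub_cancel] at hβ
      obtain ⟨t, ht, ⟨k, hk⟩, hle⟩ := exists_max_multiple (β := β) hp (by
        by_contra! hcon
        have := Finset.sum_nonpos (s := Finset.univ) (f := β) fun i _ => hcon i
        linarith)
      have hsum1 : ∑ l, (θ l - t * β l) = 1 - t := by
        simp [Finset.sum_sub_distrib, ← Finset.mul_sum, h1, hβ1]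
      have hsumq : ∑ l, (θ l - t * β l) • q l = x - t • a := by
        simp [sub_smul, Finset.sum_sub_distrib, mul_smul, ← Finset.smul_sum, hβ, ← hxq]
      have hcompl1 := Fintype.sum_eq_add_sum_compl i fun l => θ l - t * β l
      have hcomplq := Fintype.sum_eq_add_sum_compl i fun l => (θ l - t * β l) • q l
      rw [hsum1] at hcompl1
      rw [hsumq] at hcomplq
      have hupd : ∀ (c : ℝ) (e : V), 0 ≤ c → c = θ i - t * β i + t → e ∈ klee C →
          c • e = (θ i - t * β i) • q i + t • a →
          (∀ l, 0 ≤ Function.update (fun l => θ l - t * β l) i c l) ∧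
          ∑ l, Function.update (fun l => θ l - t * β l) i c l = 1 ∧
          (∀ l, Function.update q i e l ∈ klee C) ∧
          x = ∑ l, Function.update (fun l => θ l - t * β l) i c l • Function.update q i e l := by
        intro c e hc hc1 he hce
        refine ⟨fun l => ?_, ?_, fun l => ?_, ?_⟩
        · rcases eq_or_ne l i with rfl | hl
          · simpa using hc
          · simpa [hl] using hle l
        · rw [Fintype.sum_eq_add_sum_compl i, Finset.sum_congr rfl
            (g := fun l => θ l - t * β l) fun l hl => by
              rw [Function.update_of_ne (by simpa using hl)]]
          simp only [Function.update_self]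
          linarith
        · rcases eq_or_ne l i with rfl | hl
          · simpa using he
          · simpa [hl] using hq l
        · rw [Fintype.sum_eq_add_sum_compl i, Finset.sum_congr rfl
            (g := fun l => (θ l - t * β l) • q l) fun l hl => by
              rw [Function.update_of_ne (by simpa using hl),
                Function.update_of_ne (by simpa using hl)]]
          simp only [Function.update_self]
          rw [hce, add_right_comm, ← hcomplq]
          abel
      by_cases hki : k = i
      · subst hki
        obtain ⟨g0, g1, gq, gx⟩ := hupd t a ht.le (by linarith) (Or.inl ha) (by simp [hk])
        refine ih _ _ g0 g1 gq gx ?_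
        have : (Finset.univ.filter fun l => Function.update q k a l ∉ C.extremePoints ℝ) =
            (Finset.univ.filter fun l => q l ∉ C.extremePoints ℝ).erase k := by
          ext l
          rcases eq_or_ne l k with rfl | hl
          · simp [ha]
          · simp [hl]
        rw [this, Finset.card_erase_of_mem hi, hs]
        rfl
      -- Here `q i` and `a` merge into a single point of the same closed ray, while the weight of `q
      -- k` is zero; this contradicts minimality.
      · exfalso
        have hci : 0 ≤ θ i - t * β i := sub_nonneg.2 (hle i)
        have hc : 0 < θ i - t * β i + t := by linarith
        obtain ⟨g0, g1, gq, gx⟩ := hupd (θ i - t * β i + t)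
          (a + ((θ i - t * β i) * u / (θ i - t * β i + t)) • v) hc.le rfl
          (hray _ (by positivity)) (by
            rw [hqi, smul_add, smul_smul, mul_div_cancel₀ _ hc.ne']
            module)
        have := hpos _ _ g0 g1 gq gx k
        rw [Function.update_of_ne hki, hk, sub_self] at this
        exact lt_irrefl _ this
  obtain ⟨θ, q, h0, h1, hq, hxq⟩ := Nat.find_spec hex
  exact ⟨r, (hspan θ q h0 h1 hq hxq).1.le, key _ θ q h0 h1 hq hxq rfl⟩

end Klee

/-! ### Passage to the quotient by the lineality space. -/

section Quotient

variable {E : Type*} [AddCommGroup E] [Module ℝ E]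

lemma mem_lineality {L : Set E} {v : E} :
    v ∈ lineality L ↔ ∀ x ∈ L, ∀ t : ℝ, x + t • v ∈ L := Iff.rfl

/-- `L` is a union of cosets of its lineality space. Through this, convex properties of `L` and of
its image correspond. -/
lemma mkQ_mem_image_iff {L : Set E} {u : E} :
    (lineality L).mkQ u ∈ (lineality L).mkQ '' L ↔ u ∈ L := by
  constructor
  · rintro ⟨w, hw, h⟩
    have h' : u - w ∈ lineality L := by
      rw [← Submodule.ker_mkQ (lineality L), LinearMap.mem_ker, map_sub, h, sub_self]
    simpa using mem_lineality.1 h' w hw 1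
  · exact fun h => ⟨u, h, rfl⟩

lemma lineality_le_dirSpace {L : Set E} {hL : Convex ℝ L} {p : E} {hp : p ∈ L} :
    lineality L ≤ dirSpace L hL p hp := fun v hv =>
  ⟨1, one_pos, mem_lineality.1 hv p hp 1, by
    simpa [sub_eq_add_neg] using mem_lineality.1 hv p hp (-1)⟩

lemma convex_image_mkQ {L : Set E} (hL : Convex ℝ L) : Convex ℝ ((lineality L).mkQ '' L) :=
  hL.linear_image _

lemma dirSpace_image_mkQ {L : Set E} (hL : Convex ℝ L) {p : E} (hp : p ∈ L) :
    dirSpace _ (convex_image_mkQ hL) ((lineality L).mkQ p) (mkQ_mem_image_iff.2 hp) =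
      (dirSpace L hL p hp).map (lineality L).mkQ := by
  ext y
  obtain ⟨v, rfl⟩ := Submodule.mkQ_surjective _ y
  have h : ∀ w, (lineality L).mkQ w ∈ dirSpace _ (convex_image_mkQ hL) ((lineality L).mkQ p)
      (mkQ_mem_image_iff.2 hp) ↔ w ∈ dirSpace L hL p hp := by
    intro w
    simp only [mem_dirSpace, ← map_smul, ← map_add, ← map_sub, mkQ_mem_image_iff]
  constructor
  · exact fun hv => ⟨v, (h v).1 hv, rfl⟩
  · rintro ⟨w, hw, e⟩
    rw [← e]
    exact (h w).2 hw

lemma linearlyClosed_image_mkQ {L : Set E} (hcl : LinearlyClosed L) :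
    LinearlyClosed ((lineality L).mkQ '' L) := by
  intro x v
  obtain ⟨x, rfl⟩ := Submodule.mkQ_surjective _ x
  obtain ⟨v, rfl⟩ := Submodule.mkQ_surjective _ v
  simp only [← map_smul, ← map_add, mkQ_mem_image_iff]
  exact hcl x v

/-- A linearly closed convex set is invariant under translation along every line it contains. -/
lemma mem_lineality_of_line {L : Set E} (hL : Convex ℝ L) (hcl : LinearlyClosed L) {x v : E}
    (h : ∀ t : ℝ, x + t • v ∈ L) : v ∈ lineality L := by
  refine mem_lineality.2 fun y hy t => ?_
  -- The points `(1 - s) • y + s • (x + (t / s) • v)` lie in `L` and tend to `y + t • v` along a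
  -- line as `s` tends to zero.
  have hmem : ∀ s : ℝ, s ∈ Set.Ioo (0 : ℝ) 1 → (y + t • v) + s • (x - y) ∈ L := by
    rintro s ⟨hs0, hs1⟩
    convert hL hy (h (t / s)) (a := 1 - s) (b := s) (by linarith) hs0.le (by ring) using 1
    match_scalars <;> field_simp
    ring
  have h0 : (0 : ℝ) ∈ closure (Set.Ioo (0 : ℝ) 1) := by
    rw [closure_Ioo (by norm_num)]
    simp
  have := (hcl (y + t • v) (x - y)).closure_subset_iff.2 hmem h0
  simpa using this

lemma lineFree_image_mkQ {L : Set E} (hL : Convex ℝ L) (hcl : LinearlyClosed L) :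
    LineFree ((lineality L).mkQ '' L) := by
  intro x v h
  obtain ⟨x, rfl⟩ := Submodule.mkQ_surjective _ x
  obtain ⟨v, rfl⟩ := Submodule.mkQ_surjective _ v
  simp only [← map_smul, ← map_add, mkQ_mem_image_iff] at h
  rw [← LinearMap.mem_ker, Submodule.ker_mkQ]
  exact mem_lineality_of_line hL hcl h

lemma IsComb.isConvexCombination {K : Submodule ℝ E} {L : Set E} {A B : Set (E ⧸ K)} {p : E}
    {r : ℕ} (h : IsComb A (K.mkQ p) r) (hAB : A ⊆ B) {N : ℤ} (hr : (r : ℤ) ≤ N) :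
    IsConvexCombination K L B p N := by
  obtain ⟨θ, q, h0, h1, hq, hp⟩ := h
  refine ⟨r, θ, q, hr, h0, h1, fun i => hAB (hq i), hp, fun P hP => ?_⟩
  refine ⟨p - ∑ i, θ i • P i, ?_, by abel⟩
  rw [← Submodule.ker_mkQ K, LinearMap.mem_ker, map_sub, hp, map_sum, sub_eq_zero]
  exact Finset.sum_congr rfl fun i _ => by rw [map_smul, (hP i).2]

lemma representedModulo_of_finrank_le {L : Set E} (hL : Convex ℝ L) (hcl : LinearlyClosed L)
    {p : E} (hp : p ∈ L)
    [FiniteDimensional ℝ ((dirSpace L hL p hp).map (lineality L).mkQ)] {k : ℤ}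
    (hk : (Module.finrank ℝ ((dirSpace L hL p hp).map (lineality L).mkQ) : ℤ) ≤ k) :
    RepresentedModulo (lineality L) L p k := by
  have hp' := mkQ_mem_image_iff.2 hp
  have hC := convex_image_mkQ hL
  constructor
  · refine ⟨elemFace _ _, isFace_elemFace hC hp', self_mem_elemFace _ _, _, ?_, hk⟩
    rw [HasDim, vectorSpan_elemFace hC hp', dirSpace_image_mkQ hL hp, Module.finrank_eq_rank]
  · have hfin : FiniteDimensional ℝ (dirSpace _ hC _ hp') := by
      rw [dirSpace_image_mkQ hL hp]
      infer_instance
    have h := klee_caratheodory hC (linearlyClosed_image_mkQ hcl) (lineFree_image_mkQ hL hcl) hp'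
    rw [dirSpace_image_mkQ hL hp] at h
    rcases h with ⟨r, hr, h⟩ | ⟨r, hr, h⟩
    · exact Or.inl (h.isConvexCombination subset_rfl (by omega))
    · exact Or.inr (h.isConvexCombination (klee_subset_extremeOrRayPoints _) (by omega))

end Quotient

/-! ### Dimension counts. -/

section Dimension

variable {E F W : Type*} [AddCommGroup E] [Module ℝ E] [AddCommGroup F] [Module ℝ F]
  [AddCommGroup W] [Module ℝ W]

lemma finrank_map_add_finrank_inf_ker (g : E →ₗ[ℝ] F) (A : Submodule ℝ E)
    [FiniteDimensional ℝ A] :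
    Module.finrank ℝ (A.map g) + Module.finrank ℝ (A ⊓ LinearMap.ker g : Submodule ℝ E) =
      Module.finrank ℝ A := by
  have h := LinearMap.finrank_range_add_finrank_ker (g.domRestrict A)
  rw [LinearMap.range_domRestrict, LinearMap.ker_domRestrict] at h
  rw [← h, ← Submodule.map_comap_subtype,
    ← LinearEquiv.finrank_eq (Submodule.equivMapOfInjective A.subtype A.injective_subtype _)]

/-- Dimension count for a subspace `U` whose part lying over `G` is contained in `D`. -/
lemma finrank_map_mkQ_add_le [FiniteDimensional ℝ W] (Φ : E →ₗ[ℝ] W) {K U D : Submodule ℝ E}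
    {G : Submodule ℝ W} (hKU : K ≤ U) (h : U ⊓ G.comap Φ ≤ D) {j : ℕ}
    (hj : Module.rank ℝ (D.map (K ⊓ LinearMap.ker Φ).mkQ) = j) :
    FiniteDimensional ℝ (U.map K.mkQ) ∧
      Module.finrank ℝ (U.map K.mkQ) + Module.finrank ℝ (K.map Φ) + Module.finrank ℝ G ≤
        Module.finrank ℝ (U.map Φ ⊔ G : Submodule ℝ W) + j := by
  set Z := K ⊓ LinearMap.ker Φ with hZ
  have hDfin : FiniteDimensional ℝ (D.map Z.mkQ) :=
    Module.rank_lt_aleph0_iff.1 (hj ▸ Cardinal.natCast_lt_aleph0)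
  have hDj : Module.finrank ℝ (D.map Z.mkQ) = j := Module.finrank_eq_of_rank_eq hj
  let φ : E ⧸ Z →ₗ[ℝ] W := Z.liftQ Φ inf_le_right
  have hφ : φ ∘ₗ Z.mkQ = Φ := Submodule.liftQ_mkQ _ _ _
  let g : E ⧸ Z →ₗ[ℝ] W ⧸ G := G.mkQ ∘ₗ φ
  let U' := U.map Z.mkQ
  -- The part of `U` lying over `G` contributes at most `j`; the rest embeds in `(Φ U + G) / G`.
  have hker : U' ⊓ LinearMap.ker g ≤ D.map Z.mkQ := by
    rintro _ ⟨⟨u, hu, rfl⟩, hg⟩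
    refine ⟨u, h ⟨hu, ?_⟩, rfl⟩
    have hg' : G.mkQ (Φ u) = 0 := hg
    rwa [← LinearMap.mem_ker, Submodule.ker_mkQ] at hg'
  have hU' : FiniteDimensional ℝ U' := by
    have := Submodule.finiteDimensional_of_le hker
    exact Module.Finite.iff_fg.2 (Submodule.fg_of_fg_map_of_fg_inf_ker g
      (Module.Finite.iff_fg.1 inferInstance) (Module.Finite.iff_fg.1 this))
  have hmapg : U'.map g ≤ (U.map Φ ⊔ G).map G.mkQ := by
    rintro _ ⟨_, ⟨u, hu, rfl⟩, rfl⟩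
    exact ⟨Φ u, Submodule.mem_sup_left ⟨u, hu, rfl⟩, rfl⟩
  have e1 := finrank_map_add_finrank_inf_ker g U'
  have e2 := finrank_map_add_finrank_inf_ker G.mkQ (U.map Φ ⊔ G)
  rw [Submodule.ker_mkQ, inf_eq_right.2 (le_sup_right : G ≤ U.map Φ ⊔ G)] at e2
  have i1 := Submodule.finrank_mono hmapg
  have i2 := Submodule.finrank_mono hker
  -- Passing from `E ⧸ Z` to `E ⧸ K` kills `K / Z`, which maps onto `Φ K` and so has dimension at
  -- least that of `K.map Φ`.
  let q : E ⧸ Z →ₗ[ℝ] E ⧸ K := Z.mapQ K LinearMap.id inf_le_left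
  have hq : U'.map q = U.map K.mkQ := by
    rw [← Submodule.map_comp]
    rfl
  have e3 := finrank_map_add_finrank_inf_ker q U'
  have i3 : K.map Z.mkQ ≤ U' ⊓ LinearMap.ker q := by
    rintro _ ⟨v, hv, rfl⟩
    refine ⟨⟨v, hKU hv, rfl⟩, ?_⟩
    change K.mkQ v = 0
    rwa [← LinearMap.mem_ker, Submodule.ker_mkQ]
  have hKfin := Submodule.finiteDimensional_of_le (i3.trans inf_le_left)
  have i4 := Submodule.finrank_mono i3
  have i5 := Submodule.finrank_map_le φ (K.map Z.mkQ)
  rw [← Submodule.map_comp, hφ] at i5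
  rw [hq] at e3
  refine ⟨?_, by omega⟩
  rw [← hq]
  infer_instance

lemma map_mkQ_lt_map_mkQ {K U U' : Submodule ℝ E} (hKU : K ≤ U) (h : U < U') :
    U.map K.mkQ < U'.map K.mkQ := by
  refine lt_of_le_of_ne (Submodule.map_mono h.le) fun he => h.ne ?_
  have := congrArg (Submodule.comap K.mkQ) he
  rwa [Submodule.comap_map_mkQ, Submodule.comap_map_mkQ, sup_eq_right.2 hKU,
    sup_eq_right.2 (hKU.trans h.le)] at this

/-- An oblique subspace of `E × ℝ` without vertical vectors projects onto a strictly larger space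
than its horizontal part. -/
lemma lt_map_fst_of_isHyperplaneIn {U : Submodule ℝ E} {D : Submodule ℝ (E × ℝ)}
    (h : IsHyperplaneIn (U.prod (⊥ : Submodule ℝ ℝ)) D) (hvert : ∀ s : ℝ, ((0 : E), s) ∈ D → s = 0) :
    U < D.map (LinearMap.fst ℝ E ℝ) := by
  obtain ⟨hle, hrank⟩ := h
  have hmem : ∀ v ∈ U, (v, (0 : ℝ)) ∈ D := fun v hv => hle ⟨hv, rfl⟩
  refine lt_of_le_of_ne (fun v hv => ⟨(v, 0), hmem v hv, rfl⟩) fun he => ?_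
  have hDle : D ≤ U.prod ⊥ := by
    rintro ⟨v, s⟩ hvs
    have hv : v ∈ U := by
      rw [he]
      exact ⟨(v, s), hvs, rfl⟩
    have := D.sub_mem hvs (hmem v hv)
    rw [Prod.mk_sub_mk, sub_self, sub_zero] at this
    exact ⟨hv, hvert s this⟩
  rw [Submodule.submoduleOf_eq_top.2 hDle, rank_subsingleton'] at hrank
  exact zero_ne_one hrank

end Dimension

/-! ### Convex functions with extended real values. -/

section Functions

variable {V : Type*} [AddCommGroup V] [Module ℝ V]

lemma IsConvexFun.le_combination {g : V → EReal} (hg : IsConvexFun g) {u v : V} {a b s t : ℝ}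
    (hu : g u ≤ a) (hv : g v ≤ b) (hs : 0 ≤ s) (ht : 0 ≤ t) (hst : s + t = 1) :
    g (s • u + t • v) ≤ ((s * a + t * b : ℝ) : EReal) :=
  hg.2 (x := (u, a)) (y := (v, b)) hu hv hs ht hst

lemma IsConvexFun.convex_levelSet {g : V → EReal} (hg : IsConvexFun g) (c : ℝ) :
    Convex ℝ (levelSet g c) := by
  intro u hu v hv s t hs ht hst
  have := hg.le_combination hu hv hs ht hst
  rwa [← add_mul, hst, one_mul] at this

lemma coe_le_coe_sub_iff {x : EReal} (hx : x ≠ ⊥) (M r : ℝ) :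
    (r : EReal) ≤ M - x ↔ x ≤ ((M - r : ℝ) : EReal) := by
  induction x with
  | bot => exact absurd rfl hx
  | top => simp only [EReal.sub_top, le_bot_iff, EReal.coe_ne_bot, top_le_iff, EReal.coe_ne_top]
  | coe x =>
    rw [← EReal.coe_sub, EReal.coe_le_coe_iff, EReal.coe_le_coe_iff]
    constructor <;> intro h <;> linarith

lemma IsConvexFun.convex_hypo_sub {g : V → EReal} (hg : IsConvexFun g) (M : ℝ) :
    Convex ℝ (hypo fun w => (M : EReal) - g w) := by
  rintro ⟨u, a⟩ hu ⟨v, b⟩ hv s t hs ht hst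
  have hu' := (coe_le_coe_sub_iff (hg.1 u) M a).1 hu
  have hv' := (coe_le_coe_sub_iff (hg.1 v) M b).1 hv
  refine (coe_le_coe_sub_iff (hg.1 _) M _).2 ?_
  refine (hg.le_combination hu' hv' hs ht hst).trans_eq (congrArg _ ?_)
  obtain rfl : t = 1 - s := by linarith
  change _ = M - (s * a + (1 - s) * b)
  ring

/-- If `g` takes at `w` a value below `a ≥ g x`, then `g` decreases strictly at `x` along
`w - x - v` for every two-sided direction `v` of the level set. -/
lemma exists_decrease {g : V → EReal} (hg : IsConvexFun g) {x v w : V} {a : ℝ} (hx : g x ≤ a)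
    (hw : g w < a) {ε : ℝ} (hv : ∀ t : ℝ, |t| ≤ ε → g (x + t • v) ≤ a) {t : ℝ} (ht : 0 < t)
    (ht1 : t ≤ 1) (htε : t ≤ ε) :
    ∃ b < a, g (x + (t / 2) • (w - x - v)) ≤ (b : EReal) := by
  obtain ⟨c, hwc, hca⟩ := EReal.lt_iff_exists_real_btwn.1 hw
  rw [EReal.coe_lt_coe_iff] at hca
  -- The target is the midpoint of `(1 - t) • x + t • w`, where the value is strictly below `a`, and
  -- `x - t • v`, where it is at most `a`.
  have h1 := hg.le_combination hx hwc.le (sub_nonneg.2 ht1) ht.le (by ring)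
  have h2 := hg.le_combination h1 (hv (-t) (by rwa [abs_neg, abs_of_pos ht]))
    (s := 1 / 2) (t := 1 / 2) (by norm_num) (by norm_num) (by norm_num)
  refine ⟨1 / 2 * ((1 - t) * a + t * c) + 1 / 2 * a, by nlinarith, ?_⟩
  convert h2 using 2
  module

end Functions

/-! ### Consequences of optimality for the direction spaces. -/

section Optimality

variable {E : Type*} [AddCommGroup E] [Module ℝ E] {m : ℕ}
  {R : E → EReal} {f : (Fin m → ℝ) → EReal} {Φ : E →ₗ[ℝ] (Fin m → ℝ)} {p : E} {c b : ℝ}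

lemma value_le_add (hp : p ∈ solutionSet R f Φ) (hRp : R p = c) (hfp : f (Φ p) = b) {u : E}
    {s t : ℝ} (hs : R u ≤ s) (ht : f (Φ u) ≤ t) : c + b ≤ s + t := by
  have := (hp u).trans (add_le_add hs ht)
  rw [hRp, hfp] at this
  exact_mod_cast this

lemma mem_solutionSet_of_add_le (hp : p ∈ solutionSet R f Φ) (hRp : R p = c) (hfp : f (Φ p) = b)
    {u : E} {s t : ℝ} (hs : R u ≤ s) (ht : f (Φ u) ≤ t) (hst : s + t ≤ c + b) :
    u ∈ solutionSet R f Φ := by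
  intro v
  refine le_trans ((add_le_add hs ht).trans ?_) (hp v)
  rw [hRp, hfp]
  exact_mod_cast hst

lemma exists_of_mem_solutionSet (hR : IsConvexFun R) (hf : IsConvexFun f) (hRp : R p = c)
    (hfp : f (Φ p) = b) {u : E} (hu : u ∈ solutionSet R f Φ) :
    ∃ s t : ℝ, R u ≤ s ∧ f (Φ u) ≤ t ∧ s + t ≤ c + b := by
  have h := hu p
  rw [hRp, hfp, ← EReal.coe_add] at h
  have hR1 := hR.1 u
  have hf1 := hf.1 (Φ u)
  generalize R u = x at *
  generalize f (Φ u) = y at *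
  induction x with
  | bot => exact absurd rfl hR1
  | top => rw [EReal.top_add_of_ne_bot hf1, top_le_iff] at h; exact absurd h (EReal.coe_ne_top _)
  | coe x =>
    induction y with
    | bot => exact absurd rfl hf1
    | top => rw [EReal.add_top_of_ne_bot hR1, top_le_iff] at h; exact absurd h (EReal.coe_ne_top _)
    | coe y => exact ⟨x, y, le_rfl, le_rfl, by exact_mod_cast h⟩

lemma convex_solutionSet (hR : IsConvexFun R) (hf : IsConvexFun f) (hp : p ∈ solutionSet R f Φ)
    (hRp : R p = c) (hfp : f (Φ p) = b) : Convex ℝ (solutionSet R f Φ) := by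
  intro u hu v hv s t hs ht hst
  obtain ⟨a₁, b₁, h1, h2, h3⟩ := exists_of_mem_solutionSet hR hf hRp hfp hu
  obtain ⟨a₂, b₂, h4, h5, h6⟩ := exists_of_mem_solutionSet hR hf hRp hfp hv
  refine mem_solutionSet_of_add_le hp hRp hfp (hR.le_combination h1 h4 hs ht hst)
    (t := s * b₁ + t * b₂) ?_ ?_
  · rw [map_add, map_smul, map_smul]
    exact hf.le_combination h2 h5 hs ht hst
  · obtain rfl : t = 1 - s := by linarith
    nlinarith

variable {hL : Convex ℝ (levelSet R c)} {hpL : p ∈ levelSet R c}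
  {hG : Convex ℝ (levelSet f b)} {hpG : Φ p ∈ levelSet f b}

lemma dirSpace_inf_comap_le (hp : p ∈ solutionSet R f Φ) (hRp : R p = c) (hfp : f (Φ p) = b)
    (hS : Convex ℝ (solutionSet R f Φ)) :
    dirSpace _ hL p hpL ⊓ (dirSpace _ hG (Φ p) hpG).comap Φ ≤ dirSpace _ hS p hp := by
  rintro v ⟨hv, hw⟩
  obtain ⟨ε, hε, hv⟩ := exists_forall_of_mem_dirSpace hv
  obtain ⟨δ, hδ, hw⟩ := exists_forall_of_mem_dirSpace (Submodule.mem_comap.1 hw)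
  have key : ∀ t : ℝ, |t| = min ε δ → p + t • v ∈ solutionSet R f Φ := by
    intro t ht
    refine mem_solutionSet_of_add_le hp hRp hfp (hv t (ht.trans_le (min_le_left _ _)))
      (t := b) ?_ le_rfl
    rw [map_add, map_smul]
    exact hw t (ht.trans_le (min_le_right _ _))
  have hm : 0 < min ε δ := lt_min hε hδ
  refine ⟨min ε δ, hm, key _ (abs_of_pos hm), ?_⟩
  have := key (-min ε δ) (by rw [abs_neg, abs_of_pos hm])
  rwa [neg_smul, ← sub_eq_add_neg] at this

/-- If `R` or `f` is not minimal at the optimal point, the two level sets do not span. -/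
lemma map_dirSpace_sup_ne_top (hR : IsConvexFun R) (hf : IsConvexFun f)
    (hp : p ∈ solutionSet R f Φ) (hRp : R p = c) (hfp : f (Φ p) = b)
    (h : iInf R < c ∨ iInf f < b) :
    (dirSpace _ hL p hpL).map Φ ⊔ dirSpace _ hG (Φ p) hpG ≠ ⊤ := by
  intro htop
  have hdec : ∀ z : Fin m → ℝ, ∃ v w, z = Φ v + w ∧ ∃ t : ℝ, 0 < t ∧ t ≤ 1 ∧
      ∀ s : ℝ, |s| ≤ t → R (p + s • v) ≤ c ∧ f (Φ p + s • w) ≤ b := by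
    intro z
    have hz : z ∈ (dirSpace _ hL p hpL).map Φ ⊔ dirSpace _ hG (Φ p) hpG := htop ▸ Submodule.mem_top
    obtain ⟨_, ⟨v, hv, rfl⟩, w, hw, rfl⟩ := Submodule.mem_sup.1 hz
    obtain ⟨ε, hε, hv⟩ := exists_forall_of_mem_dirSpace hv
    obtain ⟨δ, hδ, hw⟩ := exists_forall_of_mem_dirSpace hw
    refine ⟨v, w, rfl, min (min ε δ) 1, lt_min (lt_min hε hδ) one_pos, min_le_right _ _,
      fun s hs => ⟨hv s ?_, hw s ?_⟩⟩
    · exact hs.trans ((min_le_left _ _).trans (min_le_left _ _))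
    · exact hs.trans ((min_le_left _ _).trans (min_le_right _ _))
  rcases h with h | h
  · obtain ⟨q, hq⟩ := iInf_lt_iff.1 h
    -- Along `q - p - v` the value of `R` drops strictly, while the image under `Φ` moves along `w`,
    -- where `f` stays at most `b`.
    obtain ⟨v, w, hz, t, ht, ht1, hvw⟩ := hdec (Φ (q - p))
    obtain ⟨a, ha, hle⟩ := exists_decrease hR hRp.le hq (fun s hs => (hvw s hs).1) ht ht1 le_rfl
    have := value_le_add hp hRp hfp hle (t := b) (by
      have h2 := (hvw (t / 2) (by rw [abs_of_pos (by positivity)]; linarith)).2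
      rwa [map_add, map_smul, map_sub Φ (q - p) v, hz, add_sub_cancel_left])
    linarith
  · obtain ⟨q, hq⟩ := iInf_lt_iff.1 h
    -- The roles are exchanged: along `v` the value of `R` stays at most `c`, and `Φ v = q - Φ p -
    -- w` lowers `f` strictly.
    obtain ⟨v, w, hz, t, ht, ht1, hvw⟩ := hdec (q - Φ p)
    obtain ⟨a, ha, hle⟩ := exists_decrease hf hfp.le hq (fun s hs => (hvw s hs).2) ht ht1 le_rfl
    have := value_le_add hp hRp hfp (u := p + (t / 2) • v) (s := c) (t := a)
      (hvw (t / 2) (by rw [abs_of_pos (by positivity)]; linarith)).1 (by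
        rwa [map_add, map_smul, show Φ v = q - Φ p - w by rw [hz]; abel])
    linarith

/-- Along `v`, `R` is bounded by `c + t * s` and `f` by `b - t * r`. Optimality for both signs of
`t` forces `s = r`, so both moved points are again minimizers. -/
lemma dirSpace_epi_inf_comap_le (hp : p ∈ solutionSet R f Φ) (hRp : R p = c) (hfp : f (Φ p) = b)
    (hf : IsConvexFun f) (hS : Convex ℝ (solutionSet R f Φ))
    {hA : Convex ℝ (epi R)} {hpA : (p, c) ∈ epi R}
    {hB : Convex ℝ (hypo fun w => ((c + b : ℝ) : EReal) - f w)}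
    {hpB : (Φ p, c) ∈ hypo fun w => ((c + b : ℝ) : EReal) - f w} :
    (dirSpace _ hA (p, c) hpA).map (LinearMap.fst ℝ E ℝ) ⊓
      ((dirSpace _ hB (Φ p, c) hpB).map (LinearMap.fst ℝ (Fin m → ℝ) ℝ)).comap Φ ≤
        dirSpace _ hS p hp := by
  rintro _ ⟨⟨⟨v, s⟩, hv, rfl⟩, ⟨⟨w, r⟩, hw, hwv⟩⟩
  change w = Φ v at hwv
  subst hwv
  change v ∈ _
  obtain ⟨ε, hε, hv⟩ := exists_forall_of_mem_dirSpace hv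
  obtain ⟨δ, hδ, hw⟩ := exists_forall_of_mem_dirSpace hw
  have hm : 0 < min ε δ := lt_min hε hδ
  have hv' : ∀ t : ℝ, |t| = min ε δ → R (p + t • v) ≤ ((c + t * s : ℝ) : EReal) :=
    fun t ht => hv t (ht.trans_le (min_le_left _ _))
  have hw' : ∀ t : ℝ, |t| = min ε δ → f (Φ (p + t • v)) ≤ ((b - t * r : ℝ) : EReal) := by
    intro t ht
    rw [map_add, map_smul]
    refine ((coe_le_coe_sub_iff (hf.1 _) _ _).1 (hw t (ht.trans_le (min_le_right _ _)))).trans_eq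
      (congrArg _ ?_)
    change c + b - (c + t * r) = _
    ring
  have h1 : |min ε δ| = min ε δ := abs_of_pos hm
  have h2 : |-min ε δ| = min ε δ := by rw [abs_neg, h1]
  have e1 := value_le_add hp hRp hfp (hv' _ h1) (hw' _ h1)
  have e2 := value_le_add hp hRp hfp (hv' _ h2) (hw' _ h2)
  refine ⟨min ε δ, hm, ?_, ?_⟩
  · exact mem_solutionSet_of_add_le hp hRp hfp (hv' _ h1) (hw' _ h1) (by linarith)
  · rw [sub_eq_add_neg, ← neg_smul]
    exact mem_solutionSet_of_add_le hp hRp hfp (hv' _ h2) (hw' _ h2) (by linarith)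

end Optimality

/-! ### Absence of vertical directions at points of a graph. -/

section Vertical

variable {V : Type*} [AddCommGroup V] [Module ℝ V]

/-- One of two opposite vertical moves from a point of the graph would leave the epigraph. This is
the hypothesis `hvert` of `lt_map_fst_of_isHyperplaneIn`. -/
lemma vertical_eq_zero_of_epi {g : V → EReal} {x : V} {c : ℝ} (hx : g x = c)
    {hA : Convex ℝ (epi g)} {hxA : (x, c) ∈ epi g} {s : ℝ}
    (h : ((0 : V), s) ∈ dirSpace _ hA (x, c) hxA) : s = 0 := by
  obtain ⟨ε, hε, h1, h2⟩ := mem_dirSpace.1 h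
  have h1 : g (x + ε • (0 : V)) ≤ ((c + ε * s : ℝ) : EReal) := h1
  have h2 : g (x - ε • (0 : V)) ≤ ((c - ε * s : ℝ) : EReal) := h2
  rw [smul_zero, add_zero, hx, EReal.coe_le_coe_iff] at h1
  rw [smul_zero, sub_zero, hx, EReal.coe_le_coe_iff] at h2
  have : ε * s = 0 := by linarith
  exact (mul_eq_zero.1 this).resolve_left hε.ne'

lemma vertical_eq_zero_of_hypo {g : V → EReal} {x : V} {c : ℝ} (hx : g x = c)
    {hA : Convex ℝ (hypo g)} {hxA : (x, c) ∈ hypo g} {s : ℝ}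
    (h : ((0 : V), s) ∈ dirSpace _ hA (x, c) hxA) : s = 0 := by
  obtain ⟨ε, hε, h1, h2⟩ := mem_dirSpace.1 h
  have h1 : ((c + ε * s : ℝ) : EReal) ≤ g (x + ε • (0 : V)) := h1
  have h2 : ((c - ε * s : ℝ) : EReal) ≤ g (x - ε • (0 : V)) := h2
  rw [smul_zero, add_zero, hx, EReal.coe_le_coe_iff] at h1
  rw [smul_zero, sub_zero, hx, EReal.coe_le_coe_iff] at h2
  have : ε * s = 0 := by linarith
  exact (mul_eq_zero.1 this).resolve_left hε.ne'

end Vertical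

end ConvexRepr

open ConvexRepr

/-! ### The three dimension bounds. -/

theorem theorem2 {E : Type*} [AddCommGroup E] [Module ℝ E] {m : ℕ}
    (R : E → EReal) (f : (Fin m → ℝ) → EReal) (Φ : E →ₗ[ℝ] (Fin m → ℝ))
    (hR : IsConvexFun R) (hf : IsConvexFun f) (hΦ : Function.Surjective Φ)
    (p : E) (hp : p ∈ solutionSet R f Φ) (hfin : R p + f (Φ p) < ⊤)
    (hclosed : LinearlyClosed (levelSet R (R p)))
    (K : Submodule ℝ E) (hK : K = lineality (levelSet R (R p)))
    (d : ℕ) (hd : d = Module.finrank ℝ (K.map Φ))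
    (ℓ : ℕ) (hℓ : HasDim (elemFace (levelSet f (f (Φ p))) (Φ p)) ℓ)
    (j : ℕ) (hj : HasDim ((K ⊓ LinearMap.ker Φ).mkQ '' elemFace (solutionSet R f Φ) p) j) :
    ((iInf R < R p ∨ iInf f < f (Φ p)) →
      RepresentedModulo K (levelSet R (R p)) p ((m : ℤ) - ℓ + j - d - 1)) ∧
    (¬ (iInf R < R p ∨ iInf f < f (Φ p)) →
      RepresentedModulo K (levelSet R (R p)) p ((m : ℤ) - ℓ + j - d)) ∧
    (DoublyOblique R f Φ p →
      RepresentedModulo K (levelSet R (R p)) p ((m : ℤ) - ℓ + j - d - 2)) := by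
  obtain ⟨c, hRp⟩ : ∃ c : ℝ, R p = c := by
    refine ⟨(R p).toReal, (EReal.coe_toReal (fun h => ?_) (hR.1 p)).symm⟩
    rw [h, EReal.top_add_of_ne_bot (hf.1 _)] at hfin
    exact lt_irrefl _ hfin
  obtain ⟨b, hfp⟩ : ∃ b : ℝ, f (Φ p) = b := by
    refine ⟨(f (Φ p)).toReal, (EReal.coe_toReal (fun h => ?_) (hf.1 _)).symm⟩
    rw [h, EReal.add_top_of_ne_bot (hR.1 _)] at hfin
    exact lt_irrefl _ hfin
  have hS := convex_solutionSet hR hf hp hRp hfp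
  have hL := hR.convex_levelSet c
  have hG := hf.convex_levelSet b
  have hpL : p ∈ levelSet R c := hRp.le
  have hpG : Φ p ∈ levelSet f b := hfp.le
  rw [hRp] at hclosed hK
  rw [hRp, hfp]
  rw [hfp, HasDim, vectorSpan_elemFace hG hpG] at hℓ
  have hℓ := Module.finrank_eq_of_rank_eq hℓ
  have hj : Module.rank ℝ ((dirSpace _ hS p hp).map (K ⊓ LinearMap.ker Φ).mkQ) = j := by
    have := hj
    rwa [HasDim, ← LinearMap.coe_toAffineMap, ← AffineMap.map_vectorSpan,
      vectorSpan_elemFace hS hp] at this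
  subst hK hd
  have hKU : lineality (levelSet R c) ≤ dirSpace _ hL p hpL := lineality_le_dirSpace
  obtain ⟨hfinU, hcount⟩ := finrank_map_mkQ_add_le Φ hKU
    (dirSpace_inf_comap_le (hL := hL) (hpL := hpL) (hG := hG) (hpG := hpG) hp hRp hfp hS) hj
  refine ⟨fun h => ?_, fun _ => ?_, fun h => ?_⟩
  · have hlt := Submodule.finrank_lt (map_dirSpace_sup_ne_top (hL := hL) (hpL := hpL) (hG := hG)
      (hpG := hpG) hR hf hp hRp hfp h)
    rw [Module.finrank_fin_fun] at hlt
    exact representedModulo_of_finrank_le hL hclosed hpL (by omega)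
  · have hle := Submodule.finrank_le
      ((dirSpace _ hL p hpL).map Φ ⊔ dirSpace _ hG (Φ p) hpG)
    rw [Module.finrank_fin_fun] at hle
    exact representedModulo_of_finrank_le hL hclosed hpL (by omega)
  · simp only [DoublyOblique, hRp, hfp, ← EReal.coe_add, ← EReal.coe_sub, EReal.toReal_coe,
      add_sub_cancel_right] at h
    obtain ⟨h1, h2⟩ := h
    have hA : Convex ℝ (epi R) := hR.2
    have hpA : (p, c) ∈ epi R := hRp.le
    have hB := hf.convex_hypo_sub (c + b)
    have hpe : ((c + b : ℝ) : EReal) - f (Φ p) = c := by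
      rw [hfp, ← EReal.coe_sub, add_sub_cancel_right]
    have hpB : (Φ p, c) ∈ hypo fun w => ((c + b : ℝ) : EReal) - f w := hpe.ge
    rw [vectorSpan_elemFace hL hpL, vectorSpan_elemFace hA hpA] at h1
    rw [vectorSpan_elemFace hG hpG, vectorSpan_elemFace hB hpB] at h2
    have hltU := lt_map_fst_of_isHyperplaneIn h1 fun s => vertical_eq_zero_of_epi hRp
    have hltG := lt_map_fst_of_isHyperplaneIn h2 fun s =>
      vertical_eq_zero_of_hypo (g := fun w => ((c + b : ℝ) : EReal) - f w) hpe
    obtain ⟨hfinU', hcount'⟩ := finrank_map_mkQ_add_le Φ (hKU.trans hltU.le)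
      (dirSpace_epi_inf_comap_le hp hRp hfp hf hS (hA := hA) (hpA := hpA) (hB := hB)
        (hpB := hpB)) hj
    -- The count is applied to the enlarged spaces; each strict inclusion yields one of the two
    -- units gained, one modulo `K` and one in the place of `ℓ`.
    have i1 := Submodule.finrank_lt_finrank_of_lt (map_mkQ_lt_map_mkQ hKU hltU)
    have i2 := Submodule.finrank_lt_finrank_of_lt hltG
    have i3 := Submodule.finrank_le
      (((dirSpace _ hA (p, c) hpA).map (LinearMap.fst ℝ E ℝ)).map Φ ⊔
        (dirSpace _ hB (Φ p, c) hpB).map (LinearMap.fst ℝ (Fin m → ℝ) ℝ))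
    rw [Module.finrank_fin_fun] at i3
    exact representedModulo_of_finrank_le hL hclosed hpL (by omega)
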